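/- Let $\Gamma$ be a finitely generated group and $\mathcal P$ a finite collection of finitely generated infinite subgroups of $\Gamma$; write $\mathcal P^\Gamma=\{\gamma P\gamma^{-1}:\gamma\in\Gamma,\ P\in\mathcal P\}$. A geodesic metric space $X$ is taut if there is $R\ge 0$ such that every point of $X$ is within distance $R$ of some bi-infinite geodesic. An open horoball of $X$ is an open subset $B$ for which there are a geodesic ray with Busemann function $b$ and a constant $C$ such that $b\le C$ on $B$ and $b\ge -C$ on $X\setminus B$. A Gromov model of $(\Gamma,\mathcal P)$ is a taut, geodesic, Gromov hyperbolic metric space $(X,d_X)$ with a properly discontinuous action of $\Gamma$ by isometries and pairwise disjoint open horoballs $B_P$ $(P\in\mathcal P^\Gamma)$, such that $\gamma B_P=B_{\gamma P\gamma^{-1}}$ for all $\gamma\in\Gamma$, the stabilizer of $B_P$ in $\Gamma$ is $P$, and $\Gamma$ acts cocompactly on $X\setminus\bigcup_{P\in\mathcal P^\Gamma}B_P$. Let $S$ be a finite symmetric generating set of $\Gamma$ such that $S\cap P$ generates $P$ for each $P\in\mathcal P$, let $|\gamma|_S$ denote the word length with respect to $S$, and let $\log_2^+ t=\max(\log_2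 t,0)$, with $\log_2^+0=0$. Let $X$ be a Gromov model of $(\Gamma,\mathcal P)$, let $o\in X$ be a base point, and put $|\gamma|_X=d_X(o,\gamma o)$ for $\gamma\in\Gamma$. Then there exist constants $\lambda\ge 1$ and $\epsilon\ge 0$ such that \[ |\gamma|_X\le\lambda\,\log_2^+|\gamma|_S+\epsilon\qquad\text{for all } P\in\mathcal P \text{ and } \gamma\in P . \] -/

import Mathlib

open scoped Pointwise

namespace RelHyp

noncomputable section

/-- Every two points are joined by a geodesic segment. -/
def IsGeodesicSpace (X : Type*) [MetricSpace X] : Prop :=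
  ∀ x y : X, ∃ c : ℝ → X, c 0 = x ∧ c (dist x y) = y ∧
    ∀ s ∈ Set.Icc 0 (dist x y), ∀ t ∈ Set.Icc 0 (dist x y), dist (c s) (c t) = |s - t|

/-- The Gromov product `(x | y)_w`. -/
def gromovProduct {X : Type*} [MetricSpace X] (w x y : X) : ℝ :=
  (dist x w + dist y w - dist x y) / 2

/-- Gromov hyperbolicity, by the inequality for Gromov products. -/
def IsGromovHyperbolic (X : Type*) [MetricSpace X] : Prop :=
  ∃ δ : ℝ, 0 ≤ δ ∧ ∀ w x y z : X,
    min (gromovProduct w x y) (gromovProduct w y z) - δ ≤ gromovProduct w x z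

/-- Every point lies at uniformly bounded distance from some bi-infinite geodesic. -/
def IsTaut (X : Type*) [MetricSpace X] : Prop :=
  ∃ R : ℝ, 0 ≤ R ∧ ∀ x : X, ∃ ℓ : ℝ → X, Isometry ℓ ∧ ∃ t : ℝ, dist x (ℓ t) ≤ R

/-- The restriction of `σ` to `[0, ∞)` is a geodesic ray. -/
def IsGeodesicRay {X : Type*} [MetricSpace X] (σ : ℝ → X) : Prop :=
  ∀ s t : ℝ, 0 ≤ s → 0 ≤ t → dist (σ s) (σ t) = |s - t|

/-- The Busemann function of a geodesic ray. -/
def busemann {X : Type*} [MetricSpace X] (σ : ℝ → X) (x : X) : ℝ :=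
  Filter.limUnder Filter.atTop fun t : ℝ => dist x (σ t) - t

/-- The limit that defines the Busemann function of a geodesic ray always exists. -/
theorem tendsto_busemann {X : Type*} [MetricSpace X] {σ : ℝ → X} (hσ : IsGeodesicRay σ) (x : X) :
    Filter.Tendsto (fun t : ℝ => dist x (σ t) - t) Filter.atTop (nhds (busemann σ x)) := by
  apply tendsto_nhds_limUnder
  have hanti : Antitone fun t : ℝ => dist x (σ (max t 0)) - max t 0 := by
    intro s t hst
    have h0 : max s 0 ≤ max t 0 := max_le_max_right 0 hst
    have h1 := hσ (max s 0) (max t 0) (le_max_right _ _) (le_max_right _ _)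
    rw [abs_sub_comm, abs_of_nonneg (sub_nonneg.mpr h0)] at h1
    have h2 := dist_triangle x (σ (max s 0)) (σ (max t 0))
    simp only
    linarith
  have hbdd : BddBelow (Set.range fun t : ℝ => dist x (σ (max t 0)) - max t 0) := by
    refine ⟨-dist x (σ 0), ?_⟩
    rintro _ ⟨t, rfl⟩
    have h1 := hσ 0 (max t 0) le_rfl (le_max_right _ _)
    rw [abs_sub_comm, sub_zero, abs_of_nonneg (le_max_right t 0)] at h1
    have h2 := dist_triangle_left (σ 0) (σ (max t 0)) x
    simp only
    linarith
  refine ⟨_, (tendsto_atTop_ciInf hanti hbdd).congr' ?_⟩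
  filter_upwards [Filter.eventually_ge_atTop (0 : ℝ)] with t ht
  rw [max_eq_left ht]

/-- An open horoball: an open set which is, up to a bounded error, a sublevel set of the Busemann
function `b` of a geodesic ray, that is, `b ≤ C` on `B` and `b ≥ -C` off `B` for some constant `C`.
In a Gromov hyperbolic space horofunctions at a boundary point are only determined up to bounded
error, and this is the customary notion of a horoball in the theory of relatively hyperbolic groups.
It contains the exact open sublevel sets `{b < c}`, and it allows for the horoballs of the
combinatorial cusp spaces, which are invariant under a group that preserves `b` only coarsely. -/
def IsOpenHoroball {X : Type*} [MetricSpace X] (B : Set X) : Prop :=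
  IsOpen B ∧ ∃ σ : ℝ → X, IsGeodesicRay σ ∧ ∃ C : ℝ,
    (∀ x ∈ B, busemann σ x ≤ C) ∧ ∀ x ∉ B, -C ≤ busemann σ x

variable {Γ : Type*} [Group Γ]

/-- The collection `Pc^Γ` of all conjugates of the subgroups in `Pc`. -/
def conjugates (Pc : Set (Subgroup Γ)) : Set (Subgroup Γ) :=
  {Q | ∃ γ : Γ, ∃ P ∈ Pc, Q = MulAut.conj γ • P}

/-- The thick part: the complement of the horoballs `B P`, `P ∈ Pc^Γ`. -/
def thickPart {X : Type*} (Pc : Set (Subgroup Γ)) (B : Subgroup Γ → Set X) : Set X :=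
  (⋃ P ∈ conjugates Pc, B P)ᶜ

/-- The sets `B P`, for `P ∈ Pc^Γ`, are the horoballs of a thick-thin decomposition of `X` (the
values of `B` at other subgroups are irrelevant). -/
structure IsThickThin {X : Type*} [MetricSpace X] [MulAction Γ X]
    (Pc : Set (Subgroup Γ)) (B : Subgroup Γ → Set X) : Prop where
  horoball : ∀ P ∈ conjugates Pc, IsOpenHoroball (B P)
  disjoint : ∀ P ∈ conjugates Pc, ∀ Q ∈ conjugates Pc, P ≠ Q → Disjoint (B P) (B Q)
  equivariant : ∀ γ : Γ, ∀ P ∈ conjugates Pc, γ • B P = B (MulAut.conj γ • P)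
  stabilizer : ∀ P ∈ conjugates Pc, MulAction.stabilizer Γ (B P) = P
  cocompact : ∃ K : Set X, IsCompact K ∧ (⋃ γ : Γ, γ • K) = thickPart Pc B

/-- `X` with its `Γ`-action is a Gromov model of `(Γ, Pc)`; in particular `(Γ, Pc)` is a relatively
hyperbolic group. -/
structure IsGromovModel (Pc : Set (Subgroup Γ)) (X : Type*) [MetricSpace X] [MulAction Γ X] :
    Prop where
  group_fg : Group.FG Γ
  finite : Pc.Finite
  peripheral_fg : ∀ P ∈ Pc, P.FG
  peripheral_infinite : ∀ P ∈ Pc, Infinite P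
  geodesic : IsGeodesicSpace X
  hyperbolic : IsGromovHyperbolic X
  taut : IsTaut X
  isometric : IsIsometricSMul Γ X
  properlyDiscontinuous : ProperlyDiscontinuousSMul Γ X
  thickThin : ∃ B : Subgroup Γ → Set X, IsThickThin Pc B

/-- An adapted generating set of `(Γ, Pc)`. -/
structure IsAdapted (Pc : Set (Subgroup Γ)) (S : Set Γ) : Prop where
  finite : S.Finite
  symmetric : ∀ s ∈ S, s⁻¹ ∈ S
  generates : Subgroup.closure S = ⊤
  generates_peripheral : ∀ P ∈ Pc, Subgroup.closure (S ∩ (P : Set Γ)) = P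

/-- The word length `|γ|_S`, for a symmetric generating set `S`. -/
def wordLength (S : Set Γ) (γ : Γ) : ℕ :=
  sInf {n | ∃ l : List Γ, l.length = n ∧ (∀ s ∈ l, s ∈ S) ∧ l.prod = γ}

/-- `|γ|_X = d(o, γ o)` for the base point `o`. -/
def orbitNorm {X : Type*} [MetricSpace X] [MulAction Γ X] (o : X) (γ : Γ) : ℝ :=
  dist o (γ • o)

/-- `log₂⁺ x = max (log₂ x) 0`; at `x = 0` the value is `0`. -/
def logTwoPlus (x : ℝ) : ℝ :=
  max (Real.logb 2 x) 0

end

end RelHyp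

namespace RelHyp

open Filter

section Metric

variable {X : Type*} [MetricSpace X]

/-! Let `γ ∈ P`, let `n` be its word length, `d` the distance from `o` to `γ • o`, and `m` the
midpoint of a geodesic between them. The Busemann function of the horoball `B P` is bounded above at
both ends, so by hyperbolicity it is at most `-d / 2` plus a constant at `m`: the geodesic dives
into the horoball. A word for `γ` gives a path in the `Γ`-orbit of `o`, where this function is
bounded below (`exists_busemann_bounds`). But a path of `n` bounded steps comes within `δ * log₂ n`
of `m`, up to a constant (`exists_dist_le_log`). Busemann functions are 1-Lipschitz, so `d / 2` is
at most that distance plus a constant. -/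

/-- The Gromov product inequality with constant `δ`. -/
def HyperbolicWith (X : Type*) [MetricSpace X] (δ : ℝ) : Prop :=
  ∀ w x y z : X, min (gromovProduct w x y) (gromovProduct w y z) - δ ≤ gromovProduct w x z

/-- The four-point inequality. -/
theorem HyperbolicWith.four_point {δ : ℝ} (h : HyperbolicWith X δ) (x y m z : X) :
    dist x y + dist m z ≤ max (dist x m + dist y z) (dist y m + dist x z) + 2 * δ := by
  have h1 := h z x m y
  simp only [gromovProduct] at h1
  rw [dist_comm m y] at h1
  rcases min_le_iff.mp (sub_le_iff_le_add.mp h1) with h2 | h2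
  · have := le_max_left (dist x m + dist y z) (dist y m + dist x z)
    linarith
  · have := le_max_right (dist x m + dist y z) (dist y m + dist x z)
    linarith

theorem busemann_le_add_dist {σ : ℝ → X} (hσ : IsGeodesicRay σ) (x y : X) :
    busemann σ x ≤ busemann σ y + dist x y := by
  refine le_of_tendsto_of_tendsto' (tendsto_busemann hσ x)
    ((tendsto_busemann hσ y).add_const (dist x y)) fun t => ?_
  have := dist_triangle x y (σ t)
  linarith

theorem busemann_ray_apply {σ : ℝ → X} (hσ : IsGeodesicRay σ) {s : ℝ} (hs : 0 ≤ s) :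
    busemann σ (σ s) = -s := by
  refine tendsto_nhds_unique (tendsto_busemann hσ (σ s)) ?_
  refine tendsto_const_nhds.congr' ?_
  filter_upwards [eventually_ge_atTop s] with t ht
  rw [hσ s t hs (hs.trans ht), abs_sub_comm, abs_of_nonneg (sub_nonneg.mpr ht)]
  ring

/-- Busemann functions are coarsely quasi-convex with linear gain at midpoints. -/
theorem busemann_midpoint_le {δ : ℝ} (h : HyperbolicWith X δ) {σ : ℝ → X} (hσ : IsGeodesicRay σ)
    {x y m : X} {r M : ℝ} (hxy : dist x y = 2 * r) (hxm : dist x m = r) (hym : dist y m = r)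
    (hx : busemann σ x ≤ M) (hy : busemann σ y ≤ M) :
    busemann σ m ≤ M - r + 2 * δ := by
  have key : busemann σ m ≤ max (busemann σ y) (busemann σ x) + (2 * δ - r) := by
    refine le_of_tendsto_of_tendsto' (tendsto_busemann hσ m)
      (((tendsto_busemann hσ y).max (tendsto_busemann hσ x)).add_const (2 * δ - r)) fun t => ?_
    -- Both distances to `m` equal `r` while `dist x y = 2 * r`: this is the gain `r`.
    have h4 := h.four_point x y m (σ t)
    rw [hxy, hxm, hym, max_add_add_left] at h4
    rw [max_sub_sub_right]
    linarith
  have := max_le hy hx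
  linarith

theorem IsGeodesicSpace.exists_midpoint (h : IsGeodesicSpace X) (x y : X) :
    ∃ m, dist x m = dist x y / 2 ∧ dist y m = dist x y / 2 := by
  obtain ⟨c, h0, h1, hc⟩ := h x y
  have hd : (0 : ℝ) ≤ dist x y := dist_nonneg
  have hm : dist x y / 2 ∈ Set.Icc 0 (dist x y) := ⟨by linarith, by linarith⟩
  refine ⟨c (dist x y / 2), ?_, ?_⟩
  · have := hc 0 ⟨le_rfl, hd⟩ _ hm
    rw [h0, zero_sub, abs_neg, abs_of_nonneg hm.1] at this
    exact this
  · have := hc (dist x y) ⟨hd, le_rfl⟩ _ hm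
    rw [h1, sub_half, abs_of_nonneg hm.1] at this
    exact this

theorem IsGeodesicSpace.preconnectedSpace (h : IsGeodesicSpace X) : PreconnectedSpace X := by
  refine ⟨isPreconnected_of_forall_pair fun x _ y _ => ?_⟩
  obtain ⟨c, h0, h1, hc⟩ := h x y
  have hd : (0 : ℝ) ≤ dist x y := dist_nonneg
  refine ⟨c '' Set.Icc 0 (dist x y), Set.subset_univ _, ⟨0, ⟨le_rfl, hd⟩, h0⟩,
    ⟨_, ⟨hd, le_rfl⟩, h1⟩, isPreconnected_Icc.image _ ?_⟩
  have hL : LipschitzOnWith 1 c (Set.Icc 0 (dist x y)) :=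
    LipschitzOnWith.of_dist_le_mul fun s hs t ht => by
      rw [hc s hs t ht, Real.dist_eq, NNReal.coe_one, one_mul]
  exact hL.continuousOn

/-- Some step of a path of at most `2 ^ k` steps comes close to the Gromov product of the ends. -/
theorem HyperbolicWith.exists_step_gromovProduct_le {δ : ℝ} (h : HyperbolicWith X δ) (w : X)
    (x : ℕ → X) (k : ℕ) : ∀ a n : ℕ, 1 ≤ n → n ≤ 2 ^ k → 0 ≤ δ →
      ∃ i, a ≤ i ∧ i < a + n ∧
        gromovProduct w (x i) (x (i + 1)) ≤ gromovProduct w (x a) (x (a + n)) + k * δ := by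
  induction k with
  | zero =>
    intro a n h1 h2 _
    obtain rfl : n = 1 := by simp at h2; omega
    exact ⟨a, le_rfl, by omega, by simp⟩
  | succ k ih =>
    intro a n h1 h2 hδ
    push_cast
    -- Bisection: each halving of the path costs one `δ`.
    rcases le_or_gt n (2 ^ k) with hn | hn
    · obtain ⟨i, hi, hi', hg⟩ := ih a n h1 hn hδ
      exact ⟨i, hi, hi', by linarith⟩
    · have hk : 1 ≤ 2 ^ k := Nat.one_le_two_pow
      rw [pow_succ] at h2
      have hsum : a + 2 ^ k + (n - 2 ^ k) = a + n := by omega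
      rcases min_le_iff.mp (sub_le_iff_le_add.mp (h w (x a) (x (a + 2 ^ k)) (x (a + n))))
        with hm | hm
      · obtain ⟨i, hi, hi', hg⟩ := ih a (2 ^ k) hk le_rfl hδ
        exact ⟨i, hi, by omega, by linarith⟩
      · obtain ⟨i, hi, hi', hg⟩ := ih (a + 2 ^ k) (n - 2 ^ k) (by omega) (by omega) hδ
        rw [hsum] at hg hi'
        exact ⟨i, by omega, hi', by linarith⟩

theorem natCast_clog_two_le (n : ℕ) : (Nat.clog 2 n : ℝ) ≤ logTwoPlus n + 1 := by
  have h1 : Nat.clog 2 n ≤ Nat.log 2 n + 1 :=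
    Nat.clog_le_of_le_pow (Nat.lt_pow_succ_log_self one_lt_two n).le
  have h2 : (Nat.log 2 n : ℝ) ≤ logTwoPlus n := by
    have := Real.natLog_le_logb n 2
    exact this.trans (le_max_left _ _)
  have h3 : (Nat.clog 2 n : ℝ) ≤ Nat.log 2 n + 1 := by exact_mod_cast h1
  linarith

/-- A path of `n` steps of size at most `L` passes at logarithmic distance from any point between
its ends. -/
theorem HyperbolicWith.exists_dist_le_log {δ : ℝ} (h : HyperbolicWith X δ) (hδ : 0 ≤ δ)
    {x : ℕ → X} {n : ℕ} (hn : 1 ≤ n) {L : ℝ} (hL : ∀ i < n, dist (x i) (x (i + 1)) ≤ L)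
    {m : X} (hm : dist (x 0) m + dist (x n) m = dist (x 0) (x n)) :
    ∃ i, dist (x i) m ≤ δ * (logTwoPlus n + 1) + L := by
  -- By `hm` the Gromov product of the ends at `m` vanishes.
  obtain ⟨i, -, hi, hg⟩ := h.exists_step_gromovProduct_le m x (Nat.clog 2 n) 0 n hn
    (Nat.le_pow_clog one_lt_two n) hδ
  rw [zero_add] at hi hg
  refine ⟨i, ?_⟩
  have hstep := hL i hi
  have htri := dist_triangle (x i) (x (i + 1)) m
  have hlog := mul_le_mul_of_nonneg_left (natCast_clog_two_le n) hδ
  simp only [gromovProduct] at hg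
  linarith

/-- The Busemann function of a ray in a taut hyperbolic space is unbounded above. -/
theorem exists_lt_busemann {δ : ℝ} (h : HyperbolicWith X δ) (ht : IsTaut X) {σ : ℝ → X}
    (hσ : IsGeodesicRay σ) (C : ℝ) : ∃ x, C < busemann σ x := by
  by_contra! hC
  obtain ⟨R, _, hR⟩ := ht
  obtain ⟨ℓ, hℓ, -⟩ := hR (σ 0)
  -- Large enough that the midpoint bound `C - r + 2 * δ` falls below the value at `ℓ 0`.
  set r : ℝ := max 0 (C + 2 * δ - busemann σ (ℓ 0) + 1)
  have hr : 0 ≤ r := le_max_left _ _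
  have hr' : C + 2 * δ - busemann σ (ℓ 0) + 1 ≤ r := le_max_right _ _
  have := busemann_midpoint_le h hσ (x := ℓ (-r)) (y := ℓ r) (m := ℓ 0) (r := r) (M := C)
    (by rw [hℓ.dist_eq, Real.dist_eq, abs_of_nonpos (by linarith)]; ring)
    (by rw [hℓ.dist_eq, Real.dist_eq, sub_zero, abs_neg, abs_of_nonneg hr])
    (by rw [hℓ.dist_eq, Real.dist_eq, sub_zero, abs_of_nonneg hr]) (hC _) (hC _)
  linarith

theorem IsOpenHoroball.nonempty {B : Set X} (hB : IsOpenHoroball B) : B.Nonempty := by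
  obtain ⟨-, σ, hσ, C, -, hC⟩ := hB
  by_contra hne
  rw [Set.not_nonempty_iff_eq_empty] at hne
  have hpos : 0 ≤ |C| + 1 := by positivity
  have := hC (σ (|C| + 1)) (by simp [hne])
  rw [busemann_ray_apply hσ hpos] at this
  linarith [le_abs_self C]

theorem IsOpenHoroball.ne_univ {δ : ℝ} (h : HyperbolicWith X δ) (ht : IsTaut X) {B : Set X}
    (hB : IsOpenHoroball B) : B ≠ Set.univ := by
  obtain ⟨-, σ, hσ, C, hC, -⟩ := hB
  rintro rfl
  obtain ⟨x, hx⟩ := exists_lt_busemann h ht hσ C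
  exact (hC x trivial).not_gt hx

end Metric

section Model

variable {Γ : Type*} [Group Γ] {Pc : Set (Subgroup Γ)} {S : Set Γ}

theorem subset_conjugates (Pc : Set (Subgroup Γ)) : Pc ⊆ conjugates Pc :=
  fun P hP => ⟨1, P, hP, by simp⟩

theorem IsAdapted.exists_list (hS : IsAdapted Pc S) (γ : Γ) :
    ∃ l : List Γ, l.length = wordLength S γ ∧ (∀ s ∈ l, s ∈ S) ∧ l.prod = γ := by
  refine Nat.sInf_mem (s := {n | ∃ l : List Γ, l.length = n ∧ (∀ s ∈ l, s ∈ S) ∧ l.prod = γ}) ?_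
  have hγ : γ ∈ (Subgroup.closure S).toSubmonoid := by rw [hS.generates]; trivial
  rw [Subgroup.closure_toSubmonoid] at hγ
  obtain ⟨l, hl, hp⟩ := Submonoid.exists_list_of_mem_closure hγ
  refine ⟨l.length, l, rfl, fun s hs => ?_, hp⟩
  rcases hl s hs with h | h
  · exact h
  · simpa using hS.symmetric _ h

variable {X : Type*} [MetricSpace X] [MulAction Γ X] {B : Subgroup Γ → Set X}

theorem IsThickThin.smul_mem_thickPart (hB : IsThickThin Pc B) {x : X}
    (hx : x ∈ thickPart Pc B) (γ : Γ) : γ • x ∈ thickPart Pc B := by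
  obtain ⟨K, -, hK⟩ := hB.cocompact
  rw [← hK] at hx ⊢
  obtain ⟨g, hg⟩ := Set.mem_iUnion.mp hx
  refine Set.mem_iUnion.mpr ⟨γ * g, ?_⟩
  rw [mul_smul]
  exact Set.smul_mem_smul_set hg

/-- Otherwise the connected space `X` would be a disjoint union of open horoballs, so `B P` would be
clopen and hence all of `X`, which tautness excludes. -/
theorem IsThickThin.thickPart_nonempty (hB : IsThickThin Pc B) (hg : IsGeodesicSpace X) {δ : ℝ}
    (h : HyperbolicWith X δ) (ht : IsTaut X) {P : Subgroup Γ} (hP : P ∈ conjugates Pc) :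
    (thickPart Pc B).Nonempty := by
  by_contra hne
  rw [Set.not_nonempty_iff_eq_empty, thickPart, Set.compl_empty_iff] at hne
  have := hg.preconnectedSpace
  have hcompl : (B P)ᶜ = ⋃ Q ∈ conjugates Pc \ {P}, B Q := by
    ext x
    simp only [Set.mem_compl_iff, Set.mem_iUnion, exists_prop]
    constructor
    · intro hx
      obtain ⟨Q, hQ, hxQ⟩ := Set.mem_iUnion₂.mp (hne ▸ Set.mem_univ x)
      exact ⟨Q, ⟨hQ, by rintro rfl; exact hx hxQ⟩, hxQ⟩
    · rintro ⟨Q, ⟨hQ, hQP⟩, hxQ⟩ hxP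
      exact Set.disjoint_left.mp (hB.disjoint Q hQ P hP hQP) hxQ hxP
  have hclopen : IsClopen (B P) := by
    refine ⟨⟨?_⟩, (hB.horoball P hP).1⟩
    rw [hcompl]
    exact isOpen_biUnion fun Q hQ => (hB.horoball Q hQ.1).1
  exact (hB.horoball P hP).ne_univ h ht (hclopen.eq_univ (hB.horoball P hP).nonempty)

/-- The Busemann function of a horoball `B P` is bounded above on `P`-orbits and below on
`Γ`-orbits. -/
theorem IsGromovModel.exists_busemann_bounds (hX : IsGromovModel Pc X) (o : X) {P : Subgroup Γ}
    (hP : P ∈ Pc) : ∃ σ : ℝ → X, IsGeodesicRay σ ∧ ∃ M : ℝ,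
      (∀ γ ∈ P, busemann σ (γ • o) ≤ M) ∧ ∀ γ : Γ, -M ≤ busemann σ (γ • o) := by
  obtain ⟨B, hB⟩ := hX.thickThin
  obtain ⟨δ, -, hδ⟩ := hX.hyperbolic
  have := hX.isometric
  have hP' := subset_conjugates Pc hP
  have hball := hB.horoball P hP'
  obtain ⟨p, hp⟩ := hball.nonempty
  obtain ⟨k, hk⟩ := hB.thickPart_nonempty hX.geodesic hδ hX.taut hP'
  obtain ⟨-, σ, hσ, C, hC, hC'⟩ := hball
  -- Translates of `p` by `P` stay in `B P`; translates of `k` by `Γ` stay in the thick part,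
  -- outside `B P`.
  refine ⟨σ, hσ, C + max (dist o p) (dist k o), fun γ hγ => ?_, fun γ => ?_⟩
  · have hstab : γ • B P = B P := by
      rw [← hB.stabilizer P hP'] at hγ
      exact hγ
    have h1 := hC (γ • p) (hstab ▸ Set.smul_mem_smul_set hp)
    have h2 := busemann_le_add_dist hσ (γ • o) (γ • p)
    rw [dist_smul] at h2
    linarith [le_max_left (dist o p) (dist k o)]
  · have h1 := hC' (γ • k) fun hmem =>
      hB.smul_mem_thickPart hk γ (Set.mem_iUnion₂.mpr ⟨P, hP', hmem⟩)
    have h2 := busemann_le_add_dist hσ (γ • k) (γ • o)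
    rw [dist_smul] at h2
    linarith [le_max_right (dist o p) (dist k o)]

theorem IsAdapted.exists_path (hS : IsAdapted Pc S) [IsIsometricSMul Γ X] {o : X} {L : ℝ}
    (hL : ∀ s ∈ S, dist o (s • o) ≤ L) (γ : Γ) :
    ∃ g : ℕ → Γ, g 0 = 1 ∧ g (wordLength S γ) = γ ∧
      ∀ i < wordLength S γ, dist (g i • o) (g (i + 1) • o) ≤ L := by
  obtain ⟨l, hlen, hmem, hprod⟩ := hS.exists_list γ
  refine ⟨fun i => (l.take i).prod, by simp, by simp [← hlen, hprod], fun i hi => ?_⟩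
  have hi' : i < l.length := hlen ▸ hi
  simp only
  rw [List.prod_take_succ l i hi', mul_smul, dist_smul]
  exact hL _ (hmem _ (List.getElem_mem hi'))

/-- The logarithmic upper bound for the elements of one peripheral subgroup. -/
theorem IsGromovModel.exists_orbitNorm_le (hX : IsGromovModel Pc X) (hS : IsAdapted Pc S) (o : X)
    {δ : ℝ} (hδ : 0 ≤ δ) (h : HyperbolicWith X δ) {P : Subgroup Γ} (hP : P ∈ Pc) :
    ∃ ε : ℝ, ∀ γ ∈ P, orbitNorm o γ ≤ (2 * δ + 1) * logTwoPlus (wordLength S γ : ℝ) + ε := by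
  have := hX.isometric
  obtain ⟨σ, hσ, M, hM, hM'⟩ := hX.exists_busemann_bounds o hP
  obtain ⟨L, hL⟩ := (hS.finite.image fun s => dist o (s • o)).bddAbove
  replace hL : ∀ s ∈ S, dist o (s • o) ≤ L := fun s hs => hL (Set.mem_image_of_mem _ hs)
  -- Comes from `-M ≤ (M - d / 2 + 2 * δ) + (δ * (log + 1) + L)`, solved for `d`.
  refine ⟨max 0 (2 * (2 * M + 3 * δ + L)), fun γ hγ => ?_⟩
  obtain ⟨g, hg0, hgn, hstep⟩ := hS.exists_path hL γ
  have hlog : 0 ≤ logTwoPlus (wordLength S γ : ℝ) := le_max_right _ _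
  rcases Nat.eq_zero_or_pos (wordLength S γ) with hn | hn
  · rw [hn, hg0] at hgn
    have : orbitNorm o γ = 0 := by simp [orbitNorm, ← hgn]
    rw [this]
    positivity
  · obtain ⟨m, hom, hγm⟩ := hX.geodesic.exists_midpoint o (γ • o)
    obtain ⟨i, hi⟩ := h.exists_dist_le_log hδ (x := fun i => g i • o) hn hstep (m := m)
      (by simp only [hg0, hgn, one_smul]; rw [hom, hγm]; ring)
    have hb := busemann_midpoint_le h hσ (by ring) hom hγm
      (by simpa using hM 1 P.one_mem) (hM γ hγ)
    have h1 := busemann_le_add_dist hσ (g i • o) m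
    have h2 := hM' (g i)
    have h3 := le_max_right 0 (2 * (2 * M + 3 * δ + L))
    simp only [orbitNorm]
    linarith

end Model

end RelHyp

theorem mainTheorem8 {Γ : Type*} [Group Γ] (Pc : Set (Subgroup Γ))
    (S : Set Γ) (hS : RelHyp.IsAdapted Pc S)
    (X : Type*) [MetricSpace X] [MulAction Γ X] (hX : RelHyp.IsGromovModel Pc X) (o : X) :
    ∃ lam ε : ℝ, 1 ≤ lam ∧ 0 ≤ ε ∧ ∀ P ∈ Pc, ∀ γ ∈ P,
      RelHyp.orbitNorm o γ ≤ lam * RelHyp.logTwoPlus (RelHyp.wordLength S γ : ℝ) + ε := by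
  obtain ⟨δ, hδ, h⟩ := hX.hyperbolic
  choose! ε hε using fun P (hP : P ∈ Pc) => hX.exists_orbitNorm_le hS o hδ h hP
  -- Only the additive constant depends on `P`, and `Pc` is finite.
  obtain ⟨E, hE⟩ := (hX.finite.image ε).bddAbove
  refine ⟨2 * δ + 1, max E 0, by linarith, le_max_right _ _, fun P hP γ hγ => ?_⟩
  have h1 := hε P hP γ hγ
  have h2 := hE (Set.mem_image_of_mem ε hP)
  linarith [le_max_left E 0]
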